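/- Let $(\Delta_n)_{n\ge 1}$ be i.i.d. real random variables on a probability space $(\Omega,\mathcal A,\mathbb P)$ with $\mathbb E[|\Delta_1|^p]<\infty$ for some $p>3$ and $\mathbb E[\Delta_1]=0$, and put $X_n=\sum_{i=1}^n\Delta_i$. Let $\alpha\in\mathbb R$ satisfy $\tfrac12<\tfrac{\alpha}{p}\le 1$. For $\eta,\varepsilon>0$ put $\varepsilon_n=\eta\, n^{\alpha/p-1}$, and for an integer $n_0\ge1$ put $$\mathcal O_{n_0}=\sum_{n=n_0}^\infty \mathbf 1\Big\{\tfrac{|X_n|}{n}>\varepsilon_n\Big\},\qquad \tilde{\mathcal O}_{n_0}=\sum_{n=n_0}^\infty \mathbf 1\Big\{\max_{k\ge n}\tfrac{|X_k|}{k^{\alpha/p}}>\varepsilon\Big\},\qquad \zeta(z,n_0)=\sum_{n=n_0}^\infty n^{-z},$$ where $\max_{k\ge n}$ denotes the supremum in $[0,\infty]$. (a) Let $\alpha>3$ and $\eta>0$. Then $\lim_{n\to\infty}\big|\tfrac{X_n}{n}\big|\,\varepsilon_n^{-1}=0$ $\mathbb P$-a.s. Moreover, there is a constant $C>0$ (which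 may depend on $\alpha,p,\eta$ and the law of $\Delta_1$) such that for all $0\le\tilde p<\alpha-3$ and all integers $n_0\ge1$ $$\sum_{n=n_0}^\infty n^{\tilde p}\sum_{m=n}^\infty\mathbb P\Big(\tfrac{|X_m|}{m}>\varepsilon_m\Big)\le C(\alpha-1)\,\zeta(\alpha-2-\tilde p,n_0)<\infty,$$ $$\mathbb E\big[\mathcal O_{n_0}^{1+\tilde p}\big]\le C(\alpha-1)\,\zeta(\alpha-2-\tilde p,n_0),$$ $$\mathbb P(\mathcal O_{n_0}\ge k)\le k^{-(1+\tilde p)}\,C(\alpha-1)\,\zeta(\alpha-2-\tilde p,n_0)\qquad\text{for all integers }k\ge1.$$ (b) Let $\alpha>2$ and $\varepsilon>0$. Then $\mathbb P$-a.s. the limits $\lim_{n\to\infty}\max_{k\ge n}\frac{|X_k|}{k^{\alpha/p}}$ and $\lim_{n\to\infty}\max_{k\ge n}\frac{|\Delta_k|}{k^{\alpha/p}}$ exist and are at most $\varepsilon$. Moreover, there is a constant $C>0$ (which may depend on $\alpha,p,\varepsilon$ and the law of $\Delta_1$) such that for all $0\le\tilde p<\alpha-2$ and all integers $n_0\ge1$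 $$\sum_{n=n_0}^\infty n^{\tilde p}\,\mathbb P\Big(\max_{k\ge n}\tfrac{|X_k|}{k^{\alpha/p}}>\varepsilon\Big)\le C\,\zeta(\alpha-1-\tilde p,n_0)<\infty,$$ $$\mathbb E\big[\tilde{\mathcal O}_{n_0}^{1+\tilde p}\big]\le C\,\zeta(\alpha-1-\tilde p,n_0)<\infty,$$ $$\mathbb P(\tilde{\mathcal O}_{n_0}\ge k)\le k^{-(1+\tilde p)}\,C\,\zeta(\alpha-1-\tilde p,n_0)\qquad\text{for all integers }k\ge1.$$ -/

import Mathlib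

open MeasureTheory ProbabilityTheory Filter Topology
open scoped ENNReal

namespace BaumKatz

/-- The partial sum `X_n = Δ_1 + ⋯ + Δ_n` (the sequence `Δ` is indexed from `1`; the value
`Δ 0` is never used). -/
noncomputable def partialSum {Ω : Type*} (Δ : ℕ → Ω → ℝ) (n : ℕ) (ω : Ω) : ℝ :=
  ∑ i ∈ Finset.Icc 1 n, Δ i ω

/-- The error tolerance `ε_n(α, η, p) = η n^(α/p - 1)`. -/
noncomputable def tolerance (α η p : ℝ) (n : ℕ) : ℝ :=
  η * (n : ℝ) ^ (α / p - 1)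

/-- The event `{ |X_n| / n > ε_n(α, η, p) }`. -/
def errorEvent {Ω : Type*} (Δ : ℕ → Ω → ℝ) (α η p : ℝ) (n : ℕ) : Set Ω :=
  {ω | |partialSum Δ n ω| / (n : ℝ) > tolerance α η p n}

/-- `max_{k ≥ n} |Y_k| / k^r`, as a supremum in `[0, ∞]`. -/
noncomputable def tailMax {Ω : Type*} (Y : ℕ → Ω → ℝ) (r : ℝ) (n : ℕ) (ω : Ω) : ℝ≥0∞ :=
  ⨆ k : ℕ, ⨆ _ : n ≤ k, ENNReal.ofReal (|Y k ω| / (k : ℝ) ^ r)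

/-- The nested event `{ max_{k ≥ n} |X_k| / k^(α/p) > ε }`. -/
def maxEvent {Ω : Type*} (Δ : ℕ → Ω → ℝ) (α p ε : ℝ) (n : ℕ) : Set Ω :=
  {ω | tailMax (partialSum Δ) (α / p) n ω > ENNReal.ofReal ε}

/-- The overlap statistic `∑_{n ≥ n₀} 1(A_n)`, with values in `[0, ∞]`. -/
noncomputable def overlap {Ω : Type*} (A : ℕ → Set Ω) (n₀ : ℕ) (ω : Ω) : ℝ≥0∞ :=
  ∑' j : ℕ, (A (n₀ + j)).indicator (fun _ => (1 : ℝ≥0∞)) ω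

/-- The Hurwitz zeta function `ζ(z, n₀) = ∑_{n ≥ n₀} n^(-z)` at a positive integer `n₀`,
as a sum in `[0, ∞]`. -/
noncomputable def zetaFrom (z : ℝ) (n₀ : ℕ) : ℝ≥0∞ :=
  ∑' j : ℕ, ENNReal.ofReal (((n₀ + j : ℕ) : ℝ) ^ (-z))

end BaumKatz

namespace BaumKatz

/-! Everything follows from one estimate, `measure_maxEvent_le`: the event that `|X_k| > ε k^r` for
some `k ≥ n`, with `r = α/p`, has probability at most `K n^(1-α)`. To prove it, call `Δ_i` a large
jump when it exceeds `δ n^r` (for `i ≤ n`) or `δ i^r` (for `i > n`). Since `r p = α`, Markov's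
inequality for the `p`-th moment bounds each jump probability by a multiple of `n^(-α)` or `i^(-α)`,
and these sum to order `n^(1-α)`. Without large jumps, every `X_k` with `k ≥ n` is a sum of
variables truncated at `δ k^r`. A Chernoff bound with `t` of order `log k / k^r` then gives
`O(k^(-α))`, because `r > 1/2` keeps the exponent of the moment generating function bounded
(`exponent_bounded`). Summing over `k ≥ n` gives `n^(1-α)` again.

The overlap moments are deterministic consequences. If all events from time `n` on lie in `B n`, the
count is at most the first `J` with `ω ∉ B (n₀ + J)`, and `J^(1+q)` is at most `1 + q` times a
weighted sum of indicators of the `B (n₀ + j)` (`overlap_rpow_le`). Integrating gives the zeta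
bound, and Markov's inequality gives the tail bound. The error events lie in the maximal events with
`ε = η`, so one estimate serves both halves. The almost sure limits are all `0`, because `K n^(1-α)
→ 0` for every `ε`. -/

/-! ### Power sums and zeta tails. -/

/-- Makes the tail series telescope. The condition `s ≥ 2` yields the factor `x / (x + 1)`, and `x +
1 ≤ 2 x` yields a constant `2` that does not depend on `s`. -/
theorem rpow_neg_le_two_mul_sub {s x : ℝ} (hs : 2 ≤ s) (h1 : 1 ≤ x) :
    x ^ (-s) ≤ 2 * (x ^ (1 - s) - (x + 1) ^ (1 - s)) := by
  have hx : 0 < x := by linarith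
  have hx1 : 0 < x + 1 := by linarith
  have key : (x + 1) ^ (1 - s) ≤ x ^ (1 - s) * (x / (x + 1)) := by
    have h : (x + 1) ^ (1 - s) = (x + 1) ^ (2 - s) * (x + 1)⁻¹ := by
      rw [← Real.rpow_neg_one, ← Real.rpow_add hx1]; congr 1; ring
    have h' : x ^ (1 - s) * (x / (x + 1)) = x ^ (2 - s) * (x + 1)⁻¹ := by
      rw [show (2 - s) = (1 - s) + 1 by ring, Real.rpow_add_one hx.ne']; field_simp
    rw [h, h']
    exact mul_le_mul_of_nonneg_right
      (Real.rpow_le_rpow_of_nonpos hx (by linarith) (by linarith)) (by positivity)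
  have h2 : x ^ (-s) = x ^ (1 - s) * x⁻¹ := by
    rw [← Real.rpow_neg_one, ← Real.rpow_add hx]; congr 1; ring
  have h3 : x⁻¹ ≤ 2 * (1 - x / (x + 1)) := by
    rw [show (1 - x / (x + 1)) = (x + 1)⁻¹ by field_simp; ring]
    rw [inv_eq_one_div, inv_eq_one_div, mul_one_div, div_le_div_iff₀ hx hx1]
    linarith
  have h4 : 0 ≤ x ^ (1 - s) := by positivity
  nlinarith [mul_le_mul_of_nonneg_left h3 h4]

/-- Tails of the series `∑ n^(-s)` for `s ≥ 2`. -/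
theorem tsum_rpow_neg_le {s : ℝ} (hs : 2 ≤ s) {n : ℕ} (hn : 1 ≤ n) :
    ∑' i : ℕ, ENNReal.ofReal (((n + i : ℕ) : ℝ) ^ (-s)) ≤
      ENNReal.ofReal (2 * (n : ℝ) ^ (1 - s)) := by
  refine ENNReal.tsum_le_of_sum_range_le fun N => ?_
  rw [← ENNReal.ofReal_sum_of_nonneg fun i _ => by positivity]
  refine ENNReal.ofReal_le_ofReal ?_
  have key : ∑ i ∈ Finset.range N, ((n + i : ℕ) : ℝ) ^ (-s) ≤
      2 * ((n : ℝ) ^ (1 - s) - ((n + N : ℕ) : ℝ) ^ (1 - s)) := by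
    induction N with
    | zero => simp
    | succ N ih =>
      rw [Finset.sum_range_succ]
      have h1 : (1 : ℝ) ≤ ((n + N : ℕ) : ℝ) := by exact_mod_cast (by omega : 1 ≤ n + N)
      have h := rpow_neg_le_two_mul_sub hs h1
      have h2 : ((n + (N + 1) : ℕ) : ℝ) = ((n + N : ℕ) : ℝ) + 1 := by push_cast; ring
      rw [h2]
      linarith
  have : 0 ≤ ((n + N : ℕ) : ℝ) ^ (1 - s) := by positivity
  linarith

theorem zetaFrom_lt_top {z : ℝ} (hz : 1 < z) (n₀ : ℕ) : zetaFrom z n₀ < ∞ := by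
  have h : Summable fun j : ℕ => ((n₀ + j : ℕ) : ℝ) ^ (-z) := by
    have := (summable_nat_add_iff n₀).2 (Real.summable_nat_rpow.2 (by linarith : -z < -1))
    simpa [add_comm] using this
  unfold zetaFrom
  rw [← ENNReal.ofReal_tsum_of_nonneg (fun j => by positivity) h]
  exact ENNReal.ofReal_lt_top

theorem zetaFrom_anti {z w : ℝ} (h : z ≤ w) {n₀ : ℕ} (hn : 1 ≤ n₀) :
    zetaFrom w n₀ ≤ zetaFrom z n₀ := by
  refine ENNReal.tsum_le_tsum fun j => ENNReal.ofReal_le_ofReal ?_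
  exact Real.rpow_le_rpow_of_exponent_le (by exact_mod_cast (by omega : 1 ≤ n₀ + j)) (by linarith)

/-! ### Moments of the overlap statistic. -/

/-- Bernoulli's inequality bounds each increment `(J+1)^(1+q) - J^(1+q)` by `(1+q) (J+1)^q`; the
increments telescope. -/
theorem rpow_one_add_le_sum {q : ℝ} (hq : 0 ≤ q) (J : ℕ) :
    (J : ℝ) ^ (1 + q) ≤ (1 + q) * ∑ j ∈ Finset.range J, ((j + 1 : ℕ) : ℝ) ^ q := by
  induction J with
  | zero => simp [Real.zero_rpow (by linarith : 1 + q ≠ 0)]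
  | succ J ih =>
    rw [Finset.sum_range_succ, mul_add]
    have hJ : (0 : ℝ) < ((J + 1 : ℕ) : ℝ) := by positivity
    have hb := one_add_mul_self_le_rpow_one_add (s := -(((J + 1 : ℕ) : ℝ))⁻¹)
      (by
        have : (((J + 1 : ℕ) : ℝ))⁻¹ ≤ 1 := inv_le_one_of_one_le₀ (by
          push_cast; linarith [(Nat.cast_nonneg J : (0 : ℝ) ≤ J)])
        linarith) (p := 1 + q) (by linarith)
    have h1 : (1 + -(((J + 1 : ℕ) : ℝ))⁻¹) = (J : ℝ) / ((J + 1 : ℕ) : ℝ) := by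
      field_simp; push_cast; ring
    rw [h1, Real.div_rpow (by positivity) hJ.le, le_div_iff₀ (by positivity)] at hb
    have h2 : ((J + 1 : ℕ) : ℝ) ^ (1 + q) = ((J + 1 : ℕ) : ℝ) ^ q * ((J + 1 : ℕ) : ℝ) := by
      rw [add_comm 1 q, Real.rpow_add_one hJ.ne']
    have h3 : (1 + (1 + q) * -(((J + 1 : ℕ) : ℝ))⁻¹) * ((J + 1 : ℕ) : ℝ) ^ (1 + q) =
        ((J + 1 : ℕ) : ℝ) ^ (1 + q) - (1 + q) * ((J + 1 : ℕ) : ℝ) ^ q := by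
      rw [h2]; field_simp; ring
    linarith

/-- If every `A m` with `m ≥ n` is contained in `B n`, then the moments of the overlap statistic
of `A` are controlled pointwise by the indicators of `B`. -/
theorem overlap_rpow_le {Ω : Type*} {A B : ℕ → Set Ω} (hAB : ∀ n m, n ≤ m → A m ⊆ B n)
    {q : ℝ} (hq : 0 ≤ q) {n₀ : ℕ} (hn : 1 ≤ n₀) (ω : Ω) :
    overlap A n₀ ω ^ (1 + q) ≤ ENNReal.ofReal (1 + q) *
      ∑' j : ℕ, ENNReal.ofReal (((n₀ + j : ℕ) : ℝ) ^ q) *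
        (B (n₀ + j)).indicator (fun _ => (1 : ℝ≥0∞)) ω := by
  classical
  by_cases h : ∃ j, ω ∉ B (n₀ + j)
  -- Leaving `B (n₀ + J)` rules out every `A m` with `m ≥ n₀ + J`, so the count is at most `J`;
  -- minimality of `J` makes the first `J` indicators of `B` equal to `1`.
  · set J := Nat.find h with hJ
    have hJs : ω ∉ B (n₀ + J) := Nat.find_spec h
    have hO : overlap A n₀ ω ≤ (J : ℝ≥0∞) := by
      unfold overlap
      rw [tsum_eq_sum (s := Finset.range J)]
      · calc _ ≤ ∑ j ∈ Finset.range J, (1 : ℝ≥0∞) :=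
              Finset.sum_le_sum fun j _ =>
                (Set.indicator_le_self' (s := A (n₀ + j)) (f := fun _ => (1 : ℝ≥0∞)) (by simp)) ω
          _ = J := by simp
      · intro j hj
        rw [Finset.mem_range, not_lt] at hj
        exact Set.indicator_of_notMem
          (fun hmem => hJs (hAB (n₀ + J) (n₀ + j) (by omega) hmem)) _
    calc overlap A n₀ ω ^ (1 + q) ≤ (J : ℝ≥0∞) ^ (1 + q) :=
          ENNReal.rpow_le_rpow hO (by linarith)
      _ = ENNReal.ofReal ((J : ℝ) ^ (1 + q)) := by
          rw [← ENNReal.ofReal_rpow_of_nonneg (by positivity) (by linarith),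
            ENNReal.ofReal_natCast]
      _ ≤ ENNReal.ofReal ((1 + q) * ∑ j ∈ Finset.range J, ((n₀ + j : ℕ) : ℝ) ^ q) := by
          refine ENNReal.ofReal_le_ofReal ((rpow_one_add_le_sum hq J).trans ?_)
          refine mul_le_mul_of_nonneg_left (Finset.sum_le_sum fun j _ => ?_) (by linarith)
          exact Real.rpow_le_rpow (by positivity) (by exact_mod_cast (by omega)) hq
      _ = ENNReal.ofReal (1 + q) *
          ∑ j ∈ Finset.range J, ENNReal.ofReal (((n₀ + j : ℕ) : ℝ) ^ q) := by
          rw [ENNReal.ofReal_mul (by linarith),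
            ENNReal.ofReal_sum_of_nonneg fun i _ => by positivity]
      _ = ENNReal.ofReal (1 + q) * ∑ j ∈ Finset.range J,
          ENNReal.ofReal (((n₀ + j : ℕ) : ℝ) ^ q) *
            (B (n₀ + j)).indicator (fun _ => (1 : ℝ≥0∞)) ω := by
          congr 1
          refine Finset.sum_congr rfl fun j hj => ?_
          have : ω ∈ B (n₀ + j) := by
            have := Nat.find_min h (Finset.mem_range.1 hj)
            simpa using this
          simp [this]
      _ ≤ _ := by gcongr; exact ENNReal.sum_le_tsum _
  -- If `ω` never leaves `B`, the weights are at least `1` and the right-hand side is infinite.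
  · push Not at h
    have : ∑' j : ℕ, ENNReal.ofReal (((n₀ + j : ℕ) : ℝ) ^ q) *
        (B (n₀ + j)).indicator (fun _ => (1 : ℝ≥0∞)) ω = ∞ := by
      refine top_le_iff.1 ?_
      calc ∞ = ∑' _ : ℕ, (1 : ℝ≥0∞) := (ENNReal.tsum_const_eq_top_of_ne_zero one_ne_zero).symm
        _ ≤ _ := ENNReal.tsum_le_tsum fun j => by
          rw [Set.indicator_of_mem (h j), mul_one, ENNReal.one_le_ofReal]
          exact Real.one_le_rpow (by exact_mod_cast (by omega)) hq
    rw [this, ENNReal.mul_top (by simp; linarith)]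
    exact le_top

theorem measurable_overlap {Ω : Type*} [MeasurableSpace Ω] {A : ℕ → Set Ω}
    (hA : ∀ n, MeasurableSet (A n)) (n₀ : ℕ) : Measurable (overlap A n₀) :=
  Measurable.tsum fun j => measurable_const.indicator (hA (n₀ + j))

/-- Weighted summation of the bound `P (B n) ≤ K n^(-β)`. -/
theorem tsum_rpow_mul_measure_le {Ω : Type*} [MeasurableSpace Ω] {P : Measure Ω}
    {B : ℕ → Set Ω} {K β : ℝ} (hK : 0 ≤ K)
    (hB : ∀ n, 1 ≤ n → P (B n) ≤ ENNReal.ofReal (K * (n : ℝ) ^ (-β))) (q : ℝ)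
    {n₀ : ℕ} (hn : 1 ≤ n₀) :
    ∑' j : ℕ, ENNReal.ofReal (((n₀ + j : ℕ) : ℝ) ^ q) * P (B (n₀ + j)) ≤
      ENNReal.ofReal K * zetaFrom (β - q) n₀ := by
  unfold zetaFrom
  rw [← ENNReal.tsum_mul_left]
  refine ENNReal.tsum_le_tsum fun j => ?_
  refine (mul_le_mul_right (hB (n₀ + j) (by omega)) _).trans ?_
  rw [← ENNReal.ofReal_mul (by positivity), ← ENNReal.ofReal_mul hK]
  refine ENNReal.ofReal_le_ofReal (le_of_eq ?_)
  have h0 : (0 : ℝ) < ((n₀ + j : ℕ) : ℝ) := by exact_mod_cast (by omega)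
  rw [show -(β - q) = q + -β by ring, Real.rpow_add h0]
  ring

theorem lintegral_overlap_rpow_le {Ω : Type*} [MeasurableSpace Ω] {P : Measure Ω}
    {A B : ℕ → Set Ω} (hAB : ∀ n m, n ≤ m → A m ⊆ B n) (hBm : ∀ n, MeasurableSet (B n))
    {K β : ℝ} (hK : 0 ≤ K)
    (hB : ∀ n, 1 ≤ n → P (B n) ≤ ENNReal.ofReal (K * (n : ℝ) ^ (-β))) {q : ℝ} (hq : 0 ≤ q)
    {n₀ : ℕ} (hn : 1 ≤ n₀) :
    ∫⁻ ω, overlap A n₀ ω ^ (1 + q) ∂P ≤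
      ENNReal.ofReal ((1 + q) * K) * zetaFrom (β - q) n₀ := by
  calc ∫⁻ ω, overlap A n₀ ω ^ (1 + q) ∂P
      ≤ ∫⁻ ω, ENNReal.ofReal (1 + q) *
      ∑' j : ℕ, ENNReal.ofReal (((n₀ + j : ℕ) : ℝ) ^ q) *
        (B (n₀ + j)).indicator (fun _ => (1 : ℝ≥0∞)) ω ∂P :=
        lintegral_mono fun ω => overlap_rpow_le hAB hq hn ω
    _ = ENNReal.ofReal (1 + q) *
        ∑' j : ℕ, ENNReal.ofReal (((n₀ + j : ℕ) : ℝ) ^ q) * P (B (n₀ + j)) := by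
        have hm : ∀ j, Measurable ((B (n₀ + j)).indicator (fun _ => (1 : ℝ≥0∞))) :=
          fun j => measurable_const.indicator (hBm _)
        rw [lintegral_const_mul _ (Measurable.tsum fun j => (hm j).const_mul _),
          lintegral_tsum fun j => ((hm j).const_mul _).aemeasurable]
        congr 2 with j
        rw [lintegral_const_mul _ (hm j), lintegral_indicator (hBm _)]
        simp
    _ ≤ _ := by
        rw [ENNReal.ofReal_mul (by linarith), mul_assoc]
        gcongr
        exact tsum_rpow_mul_measure_le hK hB q hn

/-- Markov's inequality for the overlap statistic. -/
theorem measure_le_overlap_le {Ω : Type*} [MeasurableSpace Ω] {P : Measure Ω}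
    {A : ℕ → Set Ω} (hA : ∀ n, MeasurableSet (A n)) {q : ℝ} (hq : 0 ≤ q) {n₀ : ℕ} {c : ℝ≥0∞}
    (hc : ∫⁻ ω, overlap A n₀ ω ^ (1 + q) ∂P ≤ c) {k : ℕ} (hk : 1 ≤ k) :
    P {ω | (k : ℝ≥0∞) ≤ overlap A n₀ ω} ≤ ENNReal.ofReal ((k : ℝ) ^ (-(1 + q))) * c := by
  have hk0 : (0 : ℝ) < k := by exact_mod_cast hk
  have hpos : (0 : ℝ) < (k : ℝ) ^ (1 + q) := by positivity
  have hset : {ω | (k : ℝ≥0∞) ≤ overlap A n₀ ω} ⊆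
      {ω | ENNReal.ofReal ((k : ℝ) ^ (1 + q)) ≤ overlap A n₀ ω ^ (1 + q)} := by
    intro ω hω
    have := ENNReal.rpow_le_rpow hω (by linarith : 0 ≤ 1 + q)
    rwa [← ENNReal.ofReal_natCast, ENNReal.ofReal_rpow_of_nonneg hk0.le (by linarith)] at this
  refine (measure_mono hset).trans ((meas_ge_le_lintegral_div
    ((measurable_overlap hA n₀).pow_const _).aemeasurable (by simpa using hpos)
    ENNReal.ofReal_ne_top).trans ?_)
  rw [Real.rpow_neg hk0.le, ENNReal.ofReal_inv_of_pos hpos, ENNReal.div_eq_inv_mul]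
  gcongr

/-! ### Truncation and exponential moments. -/

theorem exp_le_quadratic (u : ℝ) : Real.exp u ≤ 1 + u + u ^ 2 * Real.exp |u| := by
  have h := Complex.norm_exp_sub_sum_le_norm_mul_exp (u : ℂ) 2
  have h2 : Complex.exp (u : ℂ) - ∑ m ∈ Finset.range 2, (u : ℂ) ^ m / (m.factorial : ℂ) =
      ((Real.exp u - (1 + u) : ℝ) : ℂ) := by
    simp [Finset.sum_range_succ]
  rw [h2, Complex.norm_real, Complex.norm_real, Real.norm_eq_abs, Real.norm_eq_abs, sq_abs] at h
  linarith [le_abs_self (Real.exp u - (1 + u))]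

/-- Truncation of a real number at level `y`. -/
noncomputable def trunc (y x : ℝ) : ℝ := if |x| ≤ y then x else 0

theorem measurable_trunc (y : ℝ) : Measurable (trunc y) :=
  Measurable.ite (measurableSet_le measurable_id.abs measurable_const) measurable_id
    measurable_const

theorem abs_trunc_le {y : ℝ} (hy : 0 ≤ y) (x : ℝ) : |trunc y x| ≤ y := by
  unfold trunc
  split_ifs with h
  · exact h
  · simpa using hy

/-- The linear term carries `x` rather than `trunc y x`, so that centering removes it after
integration. The `p`-th power term pays for this: beyond the truncation level, `|x| ≤ y^(1-p)
|x|^p`. -/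
theorem exp_trunc_le {p y : ℝ} (hp : 1 ≤ p) (hy : 0 < y) (t x : ℝ) :
    Real.exp (t * trunc y x) ≤
      1 + t * x + |t| * y ^ (1 - p) * |x| ^ p + t ^ 2 * Real.exp (|t| * y) * x ^ 2 := by
  have ha : 0 ≤ |t| * y ^ (1 - p) * |x| ^ p := by positivity
  unfold trunc
  split_ifs with h
  · have h1 := exp_le_quadratic (t * x)
    have h2 : Real.exp |t * x| ≤ Real.exp (|t| * y) := by
      rw [abs_mul]; gcongr
    have h3 := mul_le_mul_of_nonneg_left h2 (sq_nonneg (t * x))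
    nlinarith
  · push Not at h
    have hx : 0 < |x| := hy.trans h
    have h1 : |x| ≤ y ^ (1 - p) * |x| ^ p := by
      have h2 : |x| ^ (1 - p) ≤ y ^ (1 - p) :=
        Real.rpow_le_rpow_of_nonpos hy h.le (by linarith)
      calc |x| = |x| ^ (1 - p) * |x| ^ p := by
            rw [← Real.rpow_add hx]; simp
        _ ≤ _ := by gcongr
    have h2 := mul_le_mul_of_nonneg_left h1 (abs_nonneg t)
    have h3 : -(t * x) ≤ |t| * |x| := by rw [← abs_mul]; exact neg_le_abs _
    have h4 : 0 ≤ t ^ 2 * Real.exp (|t| * y) * x ^ 2 := by positivity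
    simp only [mul_zero, Real.exp_zero]
    nlinarith

section moments

variable {Ω : Type*} [MeasurableSpace Ω] {P : Measure Ω} [IsProbabilityMeasure P]

theorem integrable_of_rpow {p : ℝ} (hp : 1 ≤ p) {X : Ω → ℝ} (hX : Measurable X)
    (h : Integrable (fun ω => |X ω| ^ p) P) : Integrable X P := by
  refine Integrable.mono' (h.add (integrable_const 1)) hX.aestronglyMeasurable
    (ae_of_all _ fun ω => ?_)
  simp only [Pi.add_apply, Real.norm_eq_abs]
  rcases le_total |X ω| 1 with h1 | h1
  · have : 0 ≤ |X ω| ^ p := by positivity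
    linarith
  · have := Real.self_le_rpow_of_one_le h1 hp
    linarith

theorem integrable_sq_of_rpow {p : ℝ} (hp : 2 ≤ p) {X : Ω → ℝ} (hX : Measurable X)
    (h : Integrable (fun ω => |X ω| ^ p) P) : Integrable (fun ω => X ω ^ 2) P := by
  refine Integrable.mono' (h.add (integrable_const 1)) (hX.pow_const 2).aestronglyMeasurable
    (ae_of_all _ fun ω => ?_)
  simp only [Pi.add_apply, Real.norm_eq_abs, abs_pow]
  rcases le_total |X ω| 1 with h1 | h1
  · have : 0 ≤ |X ω| ^ p := by positivity
    have := pow_le_one₀ (abs_nonneg (X ω)) h1 (n := 2)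
    linarith
  · have := Real.rpow_le_rpow_of_exponent_le h1 hp
    rw [Real.rpow_two] at this
    linarith

theorem integrable_exp_of_abs_le {X : Ω → ℝ} (hX : Measurable X) {c : ℝ} (hc : ∀ ω, |X ω| ≤ c)
    (t : ℝ) : Integrable (fun ω => Real.exp (t * X ω)) P := by
  refine Integrable.mono' (integrable_const (Real.exp (|t| * c)))
    (Real.measurable_exp.comp (hX.const_mul t)).aestronglyMeasurable (ae_of_all _ fun ω => ?_)
  rw [Real.norm_eq_abs, Real.abs_exp, Real.exp_le_exp]
  calc t * X ω ≤ |t * X ω| := le_abs_self _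
    _ = |t| * |X ω| := abs_mul _ _
    _ ≤ _ := by gcongr; exact hc ω

/-- Moment generating function of a truncated centered random variable. -/
theorem mgf_trunc_le {p y : ℝ} (hp : 2 ≤ p) (hy : 0 < y) {X : Ω → ℝ} (hX : Measurable X)
    (h : Integrable (fun ω => |X ω| ^ p) P) (h0 : ∫ ω, X ω ∂P = 0) (t : ℝ) :
    mgf (fun ω => trunc y (X ω)) P t ≤
      Real.exp (|t| * y ^ (1 - p) * (∫ ω, |X ω| ^ p ∂P) +
        t ^ 2 * Real.exp (|t| * y) * ∫ ω, X ω ^ 2 ∂P) := by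
  have i1 := integrable_of_rpow (by linarith : (1 : ℝ) ≤ p) hX h
  have i2 := integrable_sq_of_rpow hp hX h
  have ia : Integrable (fun ω => 1 + t * X ω) P := (integrable_const _).add (i1.const_mul t)
  have ib := h.const_mul (|t| * y ^ (1 - p))
  have ic := i2.const_mul (t ^ 2 * Real.exp (|t| * y))
  have iab : Integrable (fun ω => 1 + t * X ω + |t| * y ^ (1 - p) * |X ω| ^ p) P := ia.add ib
  have h1 : mgf (fun ω => trunc y (X ω)) P t ≤ ∫ ω, (1 + t * X ω + |t| * y ^ (1 - p) * |X ω| ^ p +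
      t ^ 2 * Real.exp (|t| * y) * X ω ^ 2) ∂P :=
    integral_mono (integrable_exp_of_abs_le ((measurable_trunc y).comp hX)
      (fun ω => abs_trunc_le hy.le _) t) (iab.add ic)
      fun ω => exp_trunc_le (by linarith) hy t (X ω)
  rw [integral_add iab ic, integral_add ia ib, integral_add (integrable_const _) (i1.const_mul t),
    integral_const_mul, integral_const_mul, integral_const_mul, h0] at h1
  simp only [integral_const, probReal_univ, smul_eq_mul, mul_one, mul_zero, add_zero] at h1
  refine h1.trans ?_
  rw [add_assoc, add_comm]
  exact Real.add_one_le_exp _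

theorem measure_abs_gt_le {p y : ℝ} (hp : 0 < p) (hy : 0 < y) {X : Ω → ℝ}
    (h : Integrable (fun ω => |X ω| ^ p) P) :
    P {ω | y < |X ω|} ≤ ENNReal.ofReal ((∫ ω, |X ω| ^ p ∂P) * y ^ (-p)) := by
  have h1 := mul_meas_ge_le_integral_of_nonneg (μ := P) (f := fun ω => |X ω| ^ p)
    (ae_of_all _ fun ω => by positivity) h (y ^ p)
  have hy' : 0 < y ^ p := by positivity
  have h2 : P {ω | y < |X ω|} ≤ P {ω | y ^ p ≤ |X ω| ^ p} :=
    measure_mono fun ω hω => Real.rpow_le_rpow hy.le (le_of_lt hω) hp.le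
  refine h2.trans ?_
  rw [← ofReal_measureReal]
  refine ENNReal.ofReal_le_ofReal ?_
  rw [Real.rpow_neg hy.le, ← div_eq_mul_inv, le_div_iff₀ hy', mul_comm]
  exact h1

/-- The Chernoff bound for a sum of truncated i.i.d. centered variables. -/
theorem measure_abs_sum_trunc_ge_le {p y : ℝ} (hp : 2 ≤ p) (hy : 0 < y) {Z : ℕ → Ω → ℝ}
    (hZ : ∀ n, Measurable (Z n)) (hindep : iIndepFun Z P)
    (hident : ∀ n, IdentDistrib (Z n) (Z 0) P P)
    (h : Integrable (fun ω => |Z 0 ω| ^ p) P) (h0 : ∫ ω, Z 0 ω ∂P = 0) (k : ℕ) (x : ℝ)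
    {t : ℝ} (ht : 0 ≤ t) :
    P {ω | x ≤ |∑ i ∈ Finset.range k, trunc y (Z i ω)|} ≤ ENNReal.ofReal (2 * (Real.exp (-t * x) *
      Real.exp (k * (t * y ^ (1 - p) * (∫ ω, |Z 0 ω| ^ p ∂P) +
        t ^ 2 * Real.exp (t * y) * ∫ ω, Z 0 ω ^ 2 ∂P)))) := by
  set S : Ω → ℝ := ∑ i ∈ Finset.range k, fun ω => trunc y (Z i ω) with hS
  have hSω : ∀ ω, ∑ i ∈ Finset.range k, trunc y (Z i ω) = S ω := fun ω => by
    simp [hS, Finset.sum_apply]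
  have hTm : ∀ i, Measurable fun ω => trunc y (Z i ω) := fun i => (measurable_trunc y).comp (hZ i)
  have hSm : Measurable S := by
    rw [← funext hSω]
    exact Finset.measurable_sum _ fun i _ => hTm i
  have hSb : ∀ ω, |S ω| ≤ k * y := fun ω => by
    rw [← hSω]
    refine (Finset.abs_sum_le_sum_abs _ _).trans ?_
    refine (Finset.sum_le_sum fun i _ => abs_trunc_le hy.le _).trans ?_
    simp
  -- The bound depends only on `|s|`, so `s = t` and `s = -t` cover the two tails, whence the factor
  -- `2`.
  have hmgf : ∀ s : ℝ, |s| = t → mgf S P s ≤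
      Real.exp (k * (t * y ^ (1 - p) * (∫ ω, |Z 0 ω| ^ p ∂P) +
        t ^ 2 * Real.exp (t * y) * ∫ ω, Z 0 ω ^ 2 ∂P)) := by
    intro s hs
    have hi : iIndepFun (fun i ω => trunc y (Z i ω)) P :=
      hindep.comp (fun _ => trunc y) fun _ => measurable_trunc y
    rw [hS, hi.mgf_sum hTm, Real.exp_nat_mul]
    have hk : ∀ i, mgf (fun ω => trunc y (Z i ω)) P s = mgf (fun ω => trunc y (Z 0 ω)) P s :=
      fun i => ((hident i).comp (u := fun x => Real.exp (s * trunc y x))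
        (Real.measurable_exp.comp ((measurable_trunc y).const_mul s))).integral_eq
    rw [Finset.prod_congr rfl fun i _ => hk i, Finset.prod_const, Finset.card_range]
    have := mgf_trunc_le hp hy (hZ 0) h h0 s
    rw [hs, ← sq_abs s, hs] at this
    exact pow_le_pow_left₀ mgf_nonneg this k
  have hup := measure_ge_le_exp_mul_mgf (μ := P) (X := S) x ht
    (integrable_exp_of_abs_le hSm hSb t)
  have hlo := measure_le_le_exp_mul_mgf (μ := P) (X := S) (-x) (neg_nonpos.2 ht)
    (integrable_exp_of_abs_le hSm hSb (-t))
  have hsub : {ω | x ≤ |∑ i ∈ Finset.range k, trunc y (Z i ω)|} ⊆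
      {ω | x ≤ S ω} ∪ {ω | S ω ≤ -x} := by
    intro ω hω
    simp only [Set.mem_ofPred_eq, hSω] at hω
    rcases le_abs.1 hω with h | h
    · exact Or.inl h
    · exact Or.inr (by simp only [Set.mem_ofPred_eq]; linarith)
  rw [← ofReal_measureReal]
  refine ENNReal.ofReal_le_ofReal ((measureReal_mono hsub).trans
    ((measureReal_union_le _ _).trans ?_))
  have e1 := mul_le_mul_of_nonneg_left (hmgf t (abs_of_nonneg ht)) (Real.exp_pos (-t * x)).le
  have e2 := mul_le_mul_of_nonneg_left (hmgf (-t) (by rw [abs_neg, abs_of_nonneg ht]))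
    (Real.exp_pos (-t * x)).le
  rw [show - -t * -x = -t * x by ring] at hlo
  linarith

end moments

/-- The exponent in the Chernoff bound stays bounded for the chosen parameters. -/
theorem exponent_bounded {p α δ ε M V : ℝ} (hp : 3 < p) (hα : 2 < α) (hr : 1 / 2 < α / p)
    (hε : 0 < ε) (hM : 0 ≤ M) (hV : 0 ≤ V) (hδ : δ = (α / p - 1 / 2) * ε / α) :
    ∃ c : ℝ, ∀ k : ℕ, 1 ≤ k →
      (k : ℝ) * (α * Real.log k / (ε * (k : ℝ) ^ (α / p)) * (δ * (k : ℝ) ^ (α / p)) ^ (1 - p) * M +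
        (α * Real.log k / (ε * (k : ℝ) ^ (α / p))) ^ 2 *
          Real.exp (α * Real.log k / (ε * (k : ℝ) ^ (α / p)) * (δ * (k : ℝ) ^ (α / p))) * V) ≤ c := by
  set r := α / p with hrdef
  set κ := r - 1 / 2 with hκ
  have hκ0 : 0 < κ := by linarith
  have hδ0 : 0 < δ := by rw [hδ]; positivity
  have hrp : r * p = α := by rw [hrdef]; field_simp
  -- The two summands bound the moment term and the variance term separately; `2 / κ` comes from
  -- `log k ≤ (2/κ) k^(κ/2)`.
  refine ⟨α / ε * δ ^ (1 - p) * M + (α / ε) ^ 2 * (2 / κ) ^ 2 * V, fun k hk => ?_⟩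
  have hk1 : (1 : ℝ) ≤ k := by exact_mod_cast hk
  have hk0 : (0 : ℝ) < k := by linarith
  have hlog : 0 ≤ Real.log k := Real.log_nonneg hk1
  -- The choice of `δ` makes `t y = κ log k`. The powers of `k` in the variance term, apart from the
  -- logarithms, are then `1 - 2r + κ = -κ`, which absorbs `log² k`.
  have hexp : Real.exp (α * Real.log k / (ε * (k : ℝ) ^ r) * (δ * (k : ℝ) ^ r)) = (k : ℝ) ^ κ := by
    rw [Real.rpow_def_of_pos hk0 κ, hδ]
    congr 1
    have : (k : ℝ) ^ r ≠ 0 := by positivity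
    field_simp
  have h1 : (k : ℝ) * (α * Real.log k / (ε * (k : ℝ) ^ r) * (δ * (k : ℝ) ^ r) ^ (1 - p) * M) ≤
      α / ε * δ ^ (1 - p) * M := by
    have hpow : (k : ℝ) * ((k : ℝ) ^ r)⁻¹ * ((k : ℝ) ^ r) ^ (1 - p) * Real.log k ≤ 1 := by
      have hl : Real.log k ≤ k := (Real.log_le_sub_one_of_pos hk0).trans (by linarith)
      have he : (k : ℝ) * ((k : ℝ) ^ r)⁻¹ * ((k : ℝ) ^ r) ^ (1 - p) = (k : ℝ) ^ (1 - α) := by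
        rw [← Real.rpow_mul hk0.le, ← Real.rpow_neg hk0.le]
        nth_rewrite 1 [← Real.rpow_one (k : ℝ)]
        rw [← Real.rpow_add hk0, ← Real.rpow_add hk0]
        congr 1
        linarith [mul_sub r 1 p]
      rw [he]
      calc (k : ℝ) ^ (1 - α) * Real.log k ≤ (k : ℝ) ^ (1 - α) * k := by gcongr
        _ = (k : ℝ) ^ (2 - α) := by
          rw [← Real.rpow_add_one hk0.ne']; congr 1; ring
        _ ≤ 1 := Real.rpow_le_one_of_one_le_of_nonpos hk1 (by linarith)
    rw [Real.mul_rpow hδ0.le (by positivity)]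
    calc _ = (α / ε * δ ^ (1 - p) * M) *
        ((k : ℝ) * ((k : ℝ) ^ r)⁻¹ * ((k : ℝ) ^ r) ^ (1 - p) * Real.log k) := by
          field_simp
      _ ≤ (α / ε * δ ^ (1 - p) * M) * 1 := by gcongr
      _ = _ := mul_one _
  have h2 : (k : ℝ) * ((α * Real.log k / (ε * (k : ℝ) ^ r)) ^ 2 * (k : ℝ) ^ κ * V) ≤
      (α / ε) ^ 2 * (2 / κ) ^ 2 * V := by
    have hl : Real.log k ≤ (2 / κ) * (k : ℝ) ^ (κ / 2) := by
      refine (Real.log_le_rpow_div hk0.le (by positivity : 0 < κ / 2)).trans (le_of_eq ?_)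
      field_simp
    have hl2 : Real.log k ^ 2 ≤ (2 / κ) ^ 2 * (k : ℝ) ^ κ := by
      calc Real.log k ^ 2 ≤ ((2 / κ) * (k : ℝ) ^ (κ / 2)) ^ 2 := by gcongr
        _ = _ := by
          rw [mul_pow, ← Real.rpow_natCast ((k : ℝ) ^ (κ / 2)), ← Real.rpow_mul hk0.le]
          congr 2
          push_cast; ring
    have he : (k : ℝ) * (((k : ℝ) ^ r) ^ 2)⁻¹ * (k : ℝ) ^ κ * (k : ℝ) ^ κ = 1 := by
      rw [← Real.rpow_natCast ((k : ℝ) ^ r), ← Real.rpow_mul hk0.le, ← Real.rpow_neg hk0.le]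
      nth_rewrite 1 [← Real.rpow_one (k : ℝ)]
      rw [← Real.rpow_add hk0, ← Real.rpow_add hk0, ← Real.rpow_add hk0]
      convert Real.rpow_zero (k : ℝ) using 2
      push_cast
      linarith
    calc _ = (α / ε) ^ 2 * V * ((k : ℝ) * (((k : ℝ) ^ r) ^ 2)⁻¹ * (k : ℝ) ^ κ) *
        Real.log k ^ 2 := by field_simp
      _ ≤ (α / ε) ^ 2 * V * ((k : ℝ) * (((k : ℝ) ^ r) ^ 2)⁻¹ * (k : ℝ) ^ κ) *
        ((2 / κ) ^ 2 * (k : ℝ) ^ κ) := by gcongr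
      _ = (α / ε) ^ 2 * (2 / κ) ^ 2 * V *
        ((k : ℝ) * (((k : ℝ) ^ r) ^ 2)⁻¹ * (k : ℝ) ^ κ * (k : ℝ) ^ κ) := by ring
      _ = _ := by rw [he, mul_one]
  rw [hexp, mul_add]
  exact add_le_add h1 h2

/-! ### The nested maximal events. -/

section nested

variable {Ω : Type*}

theorem tailMax_antitone (Y : ℕ → Ω → ℝ) (r : ℝ) (ω : Ω) :
    Antitone fun n => tailMax Y r n ω := by
  intro n m hnm
  exact iSup_mono fun k => iSup_mono' fun h => ⟨hnm.trans h, le_rfl⟩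

theorem maxEvent_antitone (Δ : ℕ → Ω → ℝ) (α p ε : ℝ) : Antitone (maxEvent Δ α p ε) :=
  fun _ _ hnm ω hω => lt_of_lt_of_le (show ENNReal.ofReal ε < tailMax _ _ _ ω from hω)
    (tailMax_antitone _ _ ω hnm)

theorem le_tailMax (Y : ℕ → Ω → ℝ) (r : ℝ) {n k : ℕ} (h : n ≤ k) (ω : Ω) :
    ENNReal.ofReal (|Y k ω| / (k : ℝ) ^ r) ≤ tailMax Y r n ω :=
  le_iSup₂_of_le k h le_rfl

theorem exists_of_mem_maxEvent {Δ : ℕ → Ω → ℝ} {α p ε : ℝ} {n : ℕ} (hn : 1 ≤ n) {ω : Ω}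
    (h : ω ∈ maxEvent Δ α p ε n) :
    ∃ k, n ≤ k ∧ ε * (k : ℝ) ^ (α / p) ≤ |partialSum Δ k ω| := by
  obtain ⟨k, hk⟩ := lt_iSup_iff.1 (show ENNReal.ofReal ε < tailMax _ _ _ _ from h)
  obtain ⟨hnk, hk⟩ := lt_iSup_iff.1 hk
  have hk0 : (0 : ℝ) < k := by exact_mod_cast hn.trans hnk
  refine ⟨k, hnk, ?_⟩
  have := (ENNReal.ofReal_lt_ofReal_iff'.1 hk).1
  rw [lt_div_iff₀ (by positivity)] at this
  exact this.le

theorem errorEvent_subset_maxEvent {Δ : ℕ → Ω → ℝ} {α p η : ℝ} (hη : 0 < η) {n m : ℕ}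
    (hnm : n ≤ m) : errorEvent Δ α η p m ⊆ maxEvent Δ α p η n := by
  intro ω hω
  have h1 : η * (m : ℝ) ^ (α / p - 1) < |partialSum Δ m ω| / m := hω
  -- At `m = 0` division by zero gives `0`, so the error event is empty.
  rcases Nat.eq_zero_or_pos m with rfl | hm
  · exfalso
    have : 0 ≤ η * ((0 : ℕ) : ℝ) ^ (α / p - 1) := by positivity
    simp only [Nat.cast_zero, div_zero] at h1 this
    linarith
  have hm0 : (0 : ℝ) < m := by exact_mod_cast hm
  refine lt_of_lt_of_le ?_ (le_tailMax _ _ hnm ω)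
  refine (ENNReal.ofReal_lt_ofReal_iff_of_nonneg hη.le).2 ?_
  rw [lt_div_iff₀ (by positivity)]
  rw [lt_div_iff₀ hm0, mul_assoc, ← Real.rpow_add_one hm0.ne', sub_add_cancel] at h1
  exact h1

variable [MeasurableSpace Ω]

theorem measurable_partialSum {Δ : ℕ → Ω → ℝ} (hmeas : ∀ n, 1 ≤ n → Measurable (Δ n)) (n : ℕ) :
    Measurable (partialSum Δ n) :=
  Finset.measurable_sum _ fun i hi => hmeas i (Finset.mem_Icc.1 hi).1

theorem measurableSet_maxEvent {Δ : ℕ → Ω → ℝ} (hmeas : ∀ n, 1 ≤ n → Measurable (Δ n))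
    (α p ε : ℝ) (n : ℕ) : MeasurableSet (maxEvent Δ α p ε n) :=
  measurableSet_lt measurable_const (Measurable.iSup fun k => Measurable.iSup fun _ =>
    ((measurable_partialSum hmeas k).abs.div_const _).ennreal_ofReal)

theorem measurableSet_errorEvent {Δ : ℕ → Ω → ℝ} (hmeas : ∀ n, 1 ≤ n → Measurable (Δ n))
    (α η p : ℝ) (n : ℕ) : MeasurableSet (errorEvent Δ α η p n) :=
  measurableSet_lt measurable_const ((measurable_partialSum hmeas n).abs.div_const _)

end nested

theorem partialSum_eq_sum_trunc {Ω : Type*} {Δ : ℕ → Ω → ℝ} {y : ℝ} {k : ℕ} {ω : Ω}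
    (h : ∀ i ∈ Finset.Icc 1 k, |Δ i ω| ≤ y) :
    partialSum Δ k ω = ∑ i ∈ Finset.range k, trunc y (Δ (i + 1) ω) := by
  unfold partialSum
  rw [Finset.range_eq_Ico, Finset.sum_Ico_add' (fun i => trunc y (Δ i ω)) 0 k 1, zero_add,
    ← Finset.Ico_succ_right_eq_Icc]
  refine Finset.sum_congr rfl fun i hi => ?_
  rw [← Finset.Ico_succ_right_eq_Icc] at h
  exact (if_pos (h i hi)).symm

/-! ### The tail estimate and the strong law. -/

section main

variable {Ω : Type*} [MeasurableSpace Ω] {P : Measure Ω} [IsProbabilityMeasure P]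

/-- A Baum–Katz type bound for the nested tail events. -/
theorem measure_maxEvent_le {Δ : ℕ → Ω → ℝ}
    (hmeas : ∀ n, 1 ≤ n → Measurable (Δ n))
    (hindep : iIndepFun (fun n : ℕ => Δ (n + 1)) P)
    (hident : ∀ n, 1 ≤ n → IdentDistrib (Δ n) (Δ 1) P P)
    {p α : ℝ} (hp : 3 < p)
    (hmoment : Integrable (fun ω => |Δ 1 ω| ^ p) P)
    (hcentered : ∫ ω, Δ 1 ω ∂P = 0)
    (hr : 1 / 2 < α / p) (hα : 2 < α) {ε : ℝ} (hε : 0 < ε) :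
    ∃ K : ℝ, 0 < K ∧ ∀ n, 1 ≤ n →
      P (maxEvent Δ α p ε n) ≤ ENNReal.ofReal (K * (n : ℝ) ^ (-(α - 1))) := by
  set δ := (α / p - 1 / 2) * ε / α with hδ
  have hδ0 : 0 < δ := by
    have : 0 < α / p - 1 / 2 := by linarith
    positivity
  set M := ∫ ω, |Δ 1 ω| ^ p ∂P with hM
  have hM0 : 0 ≤ M := integral_nonneg fun ω => by positivity
  set V := ∫ ω, Δ 1 ω ^ 2 ∂P with hV
  have hV0 : 0 ≤ V := integral_nonneg fun ω => by positivity
  obtain ⟨c, hc⟩ := exponent_bounded hp hα hr hε hM0 hV0 hδ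
  set r := α / p with hrdef
  have hrp : r * p = α := by rw [hrdef]; field_simp
  set J := M * δ ^ (-p) with hJ
  have hJ0 : 0 ≤ J := by positivity
  set T := 2 * Real.exp c with hT
  have hT0 : 0 < T := by positivity
  have hjump : ∀ i k : ℕ, 1 ≤ i → 1 ≤ k →
      P {ω | δ * (k : ℝ) ^ r < |Δ i ω|} ≤ ENNReal.ofReal (J * (k : ℝ) ^ (-α)) := by
    intro i k hi hk
    have hk0 : (0 : ℝ) < k := by exact_mod_cast hk
    have h1 : P {ω | δ * (k : ℝ) ^ r < |Δ i ω|} = P {ω | δ * (k : ℝ) ^ r < |Δ 1 ω|} :=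
      (hident i hi).measure_mem_eq (s := {x | δ * (k : ℝ) ^ r < |x|})
        (measurableSet_lt measurable_const measurable_id.abs)
    rw [h1]
    refine (measure_abs_gt_le (by linarith) (by positivity) hmoment).trans (le_of_eq ?_)
    rw [Real.mul_rpow hδ0.le (by positivity), ← Real.rpow_mul hk0.le, hJ, mul_assoc,
      mul_neg, hrp]
  have hsum : ∀ k : ℕ, 1 ≤ k →
      P {ω | ε * (k : ℝ) ^ r ≤ |∑ i ∈ Finset.range k, trunc (δ * (k : ℝ) ^ r) (Δ (i + 1) ω)|} ≤
        ENNReal.ofReal (T * (k : ℝ) ^ (-α)) := by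
    intro k hk
    have hk1 : (1 : ℝ) ≤ k := by exact_mod_cast hk
    have hk0 : (0 : ℝ) < k := by linarith
    have hlog : 0 ≤ Real.log k := Real.log_nonneg hk1
    -- This `t` makes `exp (-t ε k^r)` exactly `k^(-α)`.
    refine (measure_abs_sum_trunc_ge_le (p := p) (Z := fun i => Δ (i + 1)) (by linarith)
      (by positivity) (fun n => hmeas _ (by omega)) hindep (fun n => hident _ (by omega)) hmoment
      hcentered k _ (t := α * Real.log k / (ε * (k : ℝ) ^ r)) (by positivity)).trans ?_
    refine ENNReal.ofReal_le_ofReal ?_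
    have h1 : Real.exp (-(α * Real.log k / (ε * (k : ℝ) ^ r)) * (ε * (k : ℝ) ^ r)) =
        (k : ℝ) ^ (-α) := by
      rw [Real.rpow_def_of_pos hk0 (-α)]
      congr 1
      have : (k : ℝ) ^ r ≠ 0 := by positivity
      field_simp
    rw [h1, hT]
    have h2 := Real.exp_le_exp.2 (hc k hk)
    have h3 : 0 ≤ (k : ℝ) ^ (-α) := by positivity
    calc _ ≤ 2 * ((k : ℝ) ^ (-α) * Real.exp c) := by gcongr
      _ = _ := by ring
  -- `J` comes from the jumps up to time `n`, `2 J` from the later jumps, and `2 T` from the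
  -- truncated sums.
  refine ⟨3 * J + 2 * T, by positivity, fun n hn => ?_⟩
  have hn0 : (0 : ℝ) < n := by exact_mod_cast hn
  -- Both jump thresholds, `δ n^r` and `δ i^r`, are at most `δ k^r` for the relevant `k`. Absence of
  -- large jumps therefore makes truncation at `δ k^r` harmless for all `k ≥ n` at once.
  have hcover : maxEvent Δ α p ε n ⊆
      (⋃ i ∈ Finset.Icc 1 n, {ω | δ * (n : ℝ) ^ r < |Δ i ω|}) ∪
      (⋃ i : ℕ, {ω | δ * ((n + i : ℕ) : ℝ) ^ r < |Δ (n + i) ω|}) ∪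
      (⋃ i : ℕ, {ω | ε * ((n + i : ℕ) : ℝ) ^ r ≤ |∑ j ∈ Finset.range (n + i),
        trunc (δ * ((n + i : ℕ) : ℝ) ^ r) (Δ (j + 1) ω)|}) := by
    intro ω hω
    obtain ⟨k, hnk, hk⟩ := exists_of_mem_maxEvent hn hω
    by_contra hcon
    simp only [Set.mem_union, Set.mem_iUnion, Set.mem_ofPred_eq, not_or, not_exists, not_lt,
      not_le] at hcon
    obtain ⟨⟨hc1, hc2⟩, hc3⟩ := hcon
    obtain ⟨l, rfl⟩ := Nat.exists_eq_add_of_le hnk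
    have h3 := hc3 l
    have hr0 : 0 ≤ r := by linarith
    rw [← partialSum_eq_sum_trunc] at h3
    · exact absurd hk (not_le.2 h3)
    · intro i hi
      rw [Finset.mem_Icc] at hi
      rcases le_total i n with hin | hin
      · refine (hc1 i (Finset.mem_Icc.2 ⟨hi.1, hin⟩)).trans ?_
        gcongr
      · obtain ⟨m, rfl⟩ := Nat.exists_eq_add_of_le hin
        refine (hc2 m).trans ?_
        gcongr
        omega
  have hb1 : P (⋃ i ∈ Finset.Icc 1 n, {ω | δ * (n : ℝ) ^ r < |Δ i ω|}) ≤
      ENNReal.ofReal (J * (n : ℝ) ^ (1 - α)) := by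
    refine (measure_biUnion_finset_le _ _).trans ((Finset.sum_le_sum fun i hi =>
      hjump i n (Finset.mem_Icc.1 hi).1 hn).trans ?_)
    rw [Finset.sum_const, Nat.card_Icc, Nat.add_sub_cancel, nsmul_eq_mul,
      ← ENNReal.ofReal_natCast, ← ENNReal.ofReal_mul (by positivity)]
    refine ENNReal.ofReal_le_ofReal (le_of_eq ?_)
    rw [show 1 - α = -α + 1 by ring, Real.rpow_add_one hn0.ne']
    ring
  have htail : ∀ (A : ℕ → Set Ω) (c : ℝ), 0 ≤ c →
      (∀ k, 1 ≤ k → P (A k) ≤ ENNReal.ofReal (c * (k : ℝ) ^ (-α))) →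
      P (⋃ i, A (n + i)) ≤ ENNReal.ofReal (2 * c * (n : ℝ) ^ (1 - α)) := by
    intro A c hc0 hA
    calc P (⋃ i, A (n + i)) ≤ ∑' i, P (A (n + i)) := measure_iUnion_le _
      _ ≤ ∑' i, ENNReal.ofReal c * ENNReal.ofReal (((n + i : ℕ) : ℝ) ^ (-α)) :=
          ENNReal.tsum_le_tsum fun i => by
            rw [← ENNReal.ofReal_mul hc0]
            exact hA _ (by omega)
      _ ≤ ENNReal.ofReal c * ENNReal.ofReal (2 * (n : ℝ) ^ (1 - α)) := by
          rw [ENNReal.tsum_mul_left]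
          gcongr
          exact tsum_rpow_neg_le hα.le hn
      _ = _ := by
          rw [← ENNReal.ofReal_mul hc0]
          congr 1; ring
  have hb2 := htail (fun k => {ω | δ * (k : ℝ) ^ r < |Δ k ω|}) J hJ0 fun k hk => hjump k k hk hk
  have hb3 := htail (fun k => {ω | ε * (k : ℝ) ^ r ≤ |∑ i ∈ Finset.range k,
    trunc (δ * (k : ℝ) ^ r) (Δ (i + 1) ω)|}) T hT0.le hsum
  refine (measure_mono hcover).trans ((measure_union_le _ _).trans
    ((add_le_add ((measure_union_le _ _).trans (add_le_add hb1 hb2)) hb3).trans (le_of_eq ?_)))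
  rw [← ENNReal.ofReal_add (by positivity) (by positivity),
    ← ENNReal.ofReal_add (by positivity) (by positivity)]
  congr 1
  rw [neg_sub]
  ring

/-- The strong law in the form `max_{k ≥ n} |X_k| / k^(α/p) → 0` almost surely. -/
theorem ae_tendsto_tailMax {Δ : ℕ → Ω → ℝ}
    (hmeas : ∀ n, 1 ≤ n → Measurable (Δ n))
    (hindep : iIndepFun (fun n : ℕ => Δ (n + 1)) P)
    (hident : ∀ n, 1 ≤ n → IdentDistrib (Δ n) (Δ 1) P P)
    {p α : ℝ} (hp : 3 < p)
    (hmoment : Integrable (fun ω => |Δ 1 ω| ^ p) P)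
    (hcentered : ∫ ω, Δ 1 ω ∂P = 0)
    (hr : 1 / 2 < α / p) (hα : 2 < α) :
    ∀ᵐ ω ∂P, Tendsto (fun n => tailMax (partialSum Δ) (α / p) n ω) atTop (𝓝 0) := by
  have key : ∀ ε : ℝ, 0 < ε → ∀ᵐ ω ∂P, ∃ n, ω ∉ maxEvent Δ α p ε n := by
    intro ε hε
    obtain ⟨K, hK, hbound⟩ :=
      measure_maxEvent_le hmeas hindep hident hp hmoment hcentered hr hα hε
    have hlim : Tendsto (fun n : ℕ => ENNReal.ofReal (K * (n : ℝ) ^ (-(α - 1)))) atTop (𝓝 0) := by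
      have h1 : Tendsto (fun n : ℕ => K * (n : ℝ) ^ (-(α - 1))) atTop (𝓝 (K * 0)) :=
        ((tendsto_rpow_neg_atTop (by linarith : 0 < α - 1)).comp
          tendsto_natCast_atTop_atTop).const_mul K
      simpa using ENNReal.tendsto_ofReal h1
    -- The exceptional set lies in every `maxEvent` at once, so its measure is below a sequence
    -- tending to `0`.
    rw [ae_iff]
    refine le_antisymm (ge_of_tendsto hlim ?_) bot_le
    filter_upwards [eventually_ge_atTop 1] with n hn
    refine (measure_mono fun ω hω => ?_).trans (hbound n hn)
    simp only [Set.mem_ofPred_eq, not_exists, not_not] at hω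
    exact hω n
  have hall : ∀ᵐ ω ∂P, ∀ j : ℕ, ∃ n, ω ∉ maxEvent Δ α p ((j : ℝ) + 1)⁻¹ n :=
    ae_all_iff.2 fun j => key _ (by positivity)
  filter_upwards [hall] with ω hω
  rw [ENNReal.tendsto_nhds_zero]
  intro e he
  have hj : Tendsto (fun j : ℕ => ENNReal.ofReal (((j : ℝ) + 1)⁻¹)) atTop (𝓝 0) := by
    simpa using ENNReal.tendsto_ofReal (tendsto_one_div_add_atTop_nhds_zero_nat (𝕜 := ℝ))
  obtain ⟨j, hj⟩ := (ENNReal.tendsto_nhds_zero.1 hj e he).exists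
  obtain ⟨n, hn⟩ := hω j
  filter_upwards [eventually_ge_atTop n] with m hm
  exact ((tailMax_antitone _ _ ω hm).trans (not_lt.1 hn)).trans hj

end main

/-! ### Consequences of the tail estimate. -/

theorem tendsto_of_tailMax {Ω : Type*} {Y : ℕ → Ω → ℝ} {r : ℝ} {ω : Ω}
    (h : Tendsto (fun n => tailMax Y r n ω) atTop (𝓝 0)) :
    Tendsto (fun n : ℕ => |Y n ω| / (n : ℝ) ^ r) atTop (𝓝 0) := by
  have h1 : Tendsto (fun n : ℕ => ENNReal.ofReal (|Y n ω| / (n : ℝ) ^ r)) atTop (𝓝 0) :=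
    tendsto_of_tendsto_of_tendsto_of_le_of_le tendsto_const_nhds h (fun _ => bot_le)
      fun n => le_tailMax Y r le_rfl ω
  have h2 := (ENNReal.tendsto_toReal ENNReal.zero_ne_top).comp h1
  refine h2.congr fun n => ?_
  exact ENNReal.toReal_ofReal (by positivity)

/-- An increment is the difference of two consecutive partial sums. The shift by `2` keeps the
earlier index positive even at `n = 0`, so its power is a genuine denominator. -/
theorem tailMax_increments_le {Ω : Type*} (Δ : ℕ → Ω → ℝ) {r : ℝ} (hr : 0 ≤ r) (n : ℕ) (ω : Ω) :
    tailMax Δ r (n + 2) ω ≤ 2 * tailMax (partialSum Δ) r n ω := by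
  refine iSup₂_le fun k hk => ?_
  obtain ⟨k, rfl⟩ : ∃ l, k = l + 1 := ⟨k - 1, by omega⟩
  have hk0 : (0 : ℝ) < k := by exact_mod_cast (by omega : 0 < k)
  have hs : Δ (k + 1) ω = partialSum Δ (k + 1) ω - partialSum Δ k ω := by
    unfold partialSum
    rw [Finset.sum_Icc_succ_top (by omega)]
    ring
  have h1 : |Δ (k + 1) ω| / ((k + 1 : ℕ) : ℝ) ^ r ≤
      |partialSum Δ (k + 1) ω| / ((k + 1 : ℕ) : ℝ) ^ r + |partialSum Δ k ω| / (k : ℝ) ^ r := by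
    calc _ ≤ (|partialSum Δ (k + 1) ω| + |partialSum Δ k ω|) / ((k + 1 : ℕ) : ℝ) ^ r := by
          rw [hs]
          gcongr
          exact abs_sub _ _
      _ ≤ _ := by
          rw [add_div]
          gcongr
          omega
  refine (ENNReal.ofReal_le_ofReal h1).trans ?_
  rw [ENNReal.ofReal_add (by positivity) (by positivity), two_mul]
  exact add_le_add (le_tailMax _ _ (by omega) ω) (le_tailMax _ _ (by omega) ω)

theorem tsum_rpow_mul_tsum_measure_le {Ω : Type*} [MeasurableSpace Ω] {P : Measure Ω}
    {A : ℕ → Set Ω} {K α : ℝ} (hK : 0 ≤ K) (hα : 3 ≤ α)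
    (hA : ∀ n, 1 ≤ n → P (A n) ≤ ENNReal.ofReal (K * (n : ℝ) ^ (-(α - 1)))) (q : ℝ)
    {n₀ : ℕ} (hn : 1 ≤ n₀) :
    ∑' j : ℕ, ENNReal.ofReal (((n₀ + j : ℕ) : ℝ) ^ q) * ∑' i : ℕ, P (A (n₀ + j + i)) ≤
      ENNReal.ofReal (2 * K) * zetaFrom (α - 2 - q) n₀ := by
  unfold zetaFrom
  rw [← ENNReal.tsum_mul_left]
  refine ENNReal.tsum_le_tsum fun j => ?_
  have h0 : (0 : ℝ) < ((n₀ + j : ℕ) : ℝ) := by exact_mod_cast (by omega)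
  have h1 : ∑' i : ℕ, P (A (n₀ + j + i)) ≤
      ENNReal.ofReal K * ENNReal.ofReal (2 * ((n₀ + j : ℕ) : ℝ) ^ (1 - (α - 1))) := by
    refine le_trans ?_ (mul_le_mul_right
      (tsum_rpow_neg_le (by linarith : 2 ≤ α - 1) (by omega : 1 ≤ n₀ + j)) _)
    rw [← ENNReal.tsum_mul_left]
    refine ENNReal.tsum_le_tsum fun i => ?_
    rw [← ENNReal.ofReal_mul hK]
    exact hA _ (by omega)
  refine (mul_le_mul_right h1 _).trans (le_of_eq ?_)
  rw [← ENNReal.ofReal_mul hK, ← ENNReal.ofReal_mul (by positivity),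
    ← ENNReal.ofReal_mul (by positivity)]
  congr 1
  rw [show -(α - 2 - q) = q + (1 - (α - 1)) by ring, Real.rpow_add h0]
  ring

end BaumKatz

/-! ### Assembly of the two halves. -/

theorem mainTheorem7 {Ω : Type*} [MeasurableSpace Ω] (P : Measure Ω) [IsProbabilityMeasure P]
    (Δ : ℕ → Ω → ℝ)
    (hmeas : ∀ n, 1 ≤ n → Measurable (Δ n))
    (hindep : iIndepFun (fun n : ℕ => Δ (n + 1)) P)
    (hident : ∀ n, 1 ≤ n → IdentDistrib (Δ n) (Δ 1) P P)
    (p α : ℝ) (hp : 3 < p)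
    (hmoment : Integrable (fun ω => |Δ 1 ω| ^ p) P)
    (hcentered : ∫ ω, Δ 1 ω ∂P = 0)
    (hα₁ : 1 / 2 < α / p) (hα₂ : α / p ≤ 1) :
    (3 < α → ∀ η : ℝ, 0 < η →
      (∀ᵐ ω ∂P, Tendsto
        (fun n : ℕ => |BaumKatz.partialSum Δ n ω / (n : ℝ)| * (BaumKatz.tolerance α η p n)⁻¹)
        atTop (𝓝 0)) ∧
      ∃ C : ℝ, 0 < C ∧ ∀ q : ℝ, 0 ≤ q → q < α - 3 → ∀ n₀ : ℕ, 1 ≤ n₀ →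
        BaumKatz.zetaFrom (α - 2 - q) n₀ < ∞ ∧
        (∑' j : ℕ, ENNReal.ofReal (((n₀ + j : ℕ) : ℝ) ^ q) *
            ∑' i : ℕ, P (BaumKatz.errorEvent Δ α η p (n₀ + j + i))
          ≤ ENNReal.ofReal (C * (α - 1)) * BaumKatz.zetaFrom (α - 2 - q) n₀) ∧
        (∫⁻ ω, BaumKatz.overlap (BaumKatz.errorEvent Δ α η p) n₀ ω ^ (1 + q) ∂P
          ≤ ENNReal.ofReal (C * (α - 1)) * BaumKatz.zetaFrom (α - 2 - q) n₀) ∧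
        ∀ k : ℕ, 1 ≤ k →
          P {ω | (k : ℝ≥0∞) ≤ BaumKatz.overlap (BaumKatz.errorEvent Δ α η p) n₀ ω}
            ≤ ENNReal.ofReal ((k : ℝ) ^ (-(1 + q))) *
              (ENNReal.ofReal (C * (α - 1)) * BaumKatz.zetaFrom (α - 2 - q) n₀)) ∧
    (2 < α → ∀ ε : ℝ, 0 < ε →
      (∀ᵐ ω ∂P, ∃ L : ℝ≥0∞, L ≤ ENNReal.ofReal ε ∧
        Tendsto (fun n : ℕ => BaumKatz.tailMax (BaumKatz.partialSum Δ) (α / p) n ω)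
          atTop (𝓝 L)) ∧
      (∀ᵐ ω ∂P, ∃ L : ℝ≥0∞, L ≤ ENNReal.ofReal ε ∧
        Tendsto (fun n : ℕ => BaumKatz.tailMax Δ (α / p) n ω) atTop (𝓝 L)) ∧
      ∃ C : ℝ, 0 < C ∧ ∀ q : ℝ, 0 ≤ q → q < α - 2 → ∀ n₀ : ℕ, 1 ≤ n₀ →
        BaumKatz.zetaFrom (α - 1 - q) n₀ < ∞ ∧
        (∑' j : ℕ, ENNReal.ofReal (((n₀ + j : ℕ) : ℝ) ^ q) *
            P (BaumKatz.maxEvent Δ α p ε (n₀ + j))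
          ≤ ENNReal.ofReal C * BaumKatz.zetaFrom (α - 1 - q) n₀) ∧
        (∫⁻ ω, BaumKatz.overlap (BaumKatz.maxEvent Δ α p ε) n₀ ω ^ (1 + q) ∂P
          ≤ ENNReal.ofReal C * BaumKatz.zetaFrom (α - 1 - q) n₀) ∧
        ∀ k : ℕ, 1 ≤ k →
          P {ω | (k : ℝ≥0∞) ≤ BaumKatz.overlap (BaumKatz.maxEvent Δ α p ε) n₀ ω}
            ≤ ENNReal.ofReal ((k : ℝ) ^ (-(1 + q))) *
              (ENNReal.ofReal C * BaumKatz.zetaFrom (α - 1 - q) n₀)) := by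
  have hp0 : 0 < p := by linarith
  have hr0 : 0 ≤ α / p := by linarith
  have hlim : 2 < α → ∀ᵐ ω ∂P, Tendsto
      (fun n => BaumKatz.tailMax (BaumKatz.partialSum Δ) (α / p) n ω) atTop (𝓝 0) :=
    fun hα => BaumKatz.ae_tendsto_tailMax hmeas hindep hident hp hmoment hcentered hα₁ hα
  refine ⟨fun hα η hη => ⟨?_, ?_⟩, fun hα ε hε => ⟨?_, ?_, ?_⟩⟩
  · filter_upwards [hlim (by linarith)] with ω hω
    have h := (BaumKatz.tendsto_of_tailMax hω).mul_const η⁻¹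
    rw [zero_mul] at h
    refine h.congr' ?_
    filter_upwards [eventually_ge_atTop 1] with n hn
    have hn0 : (0 : ℝ) < n := by exact_mod_cast hn
    unfold BaumKatz.tolerance
    rw [Real.rpow_sub_one hn0.ne', abs_div, abs_of_pos hn0]
    have : (n : ℝ) ^ (α / p) ≠ 0 := by positivity
    field_simp
  · obtain ⟨K, hK, hbound⟩ := BaumKatz.measure_maxEvent_le hmeas hindep hident hp hmoment
      hcentered hα₁ (by linarith) hη
    -- The constant must not depend on `q`. The moment bound has factor `(1 + q) K` with `1 + q < α
    -- - 2`, and the double sum has factor `2 K`; both are at most `2 K (α - 1)`. The moment bound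
    -- even holds with the smaller `zetaFrom (α - 1 - q)`.
    refine ⟨2 * K, by positivity, fun q hq hqα n₀ hn => ?_⟩
    have hAB : ∀ n m, n ≤ m → BaumKatz.errorEvent Δ α η p m ⊆ BaumKatz.maxEvent Δ α p η n :=
      fun n m hnm => BaumKatz.errorEvent_subset_maxEvent hη hnm
    have hE : ∫⁻ ω, BaumKatz.overlap (BaumKatz.errorEvent Δ α η p) n₀ ω ^ (1 + q) ∂P
          ≤ ENNReal.ofReal (2 * K * (α - 1)) * BaumKatz.zetaFrom (α - 2 - q) n₀ := by
      refine (BaumKatz.lintegral_overlap_rpow_le hAB (BaumKatz.measurableSet_maxEvent hmeas α p η)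
        hK.le hbound hq hn).trans (mul_le_mul' (ENNReal.ofReal_le_ofReal ?_)
          (BaumKatz.zetaFrom_anti (by linarith) hn))
      nlinarith
    refine ⟨BaumKatz.zetaFrom_lt_top (by linarith) n₀, ?_, hE, fun k hk =>
      BaumKatz.measure_le_overlap_le (BaumKatz.measurableSet_errorEvent hmeas α η p) hq hE hk⟩
    refine (BaumKatz.tsum_rpow_mul_tsum_measure_le hK.le hα.le (fun n hn =>
      (measure_mono (hAB n n le_rfl)).trans (hbound n hn)) q hn).trans
        (mul_le_mul_left (ENNReal.ofReal_le_ofReal ?_) _)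
    nlinarith
  · filter_upwards [hlim hα] with ω hω
    exact ⟨0, bot_le, hω⟩
  · filter_upwards [hlim hα] with ω hω
    refine ⟨0, bot_le, (tendsto_add_atTop_iff_nat 2).1 ?_⟩
    have h := ENNReal.Tendsto.const_mul hω (Or.inr (by simp : (2 : ℝ≥0∞) ≠ ∞))
    rw [mul_zero] at h
    exact tendsto_of_tendsto_of_tendsto_of_le_of_le tendsto_const_nhds h (fun _ => bot_le)
      fun n => BaumKatz.tailMax_increments_le Δ hr0 n ω
  · obtain ⟨K, hK, hbound⟩ := BaumKatz.measure_maxEvent_le hmeas hindep hident hp hmoment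
      hcentered hα₁ hα hε
    -- Here `1 + q < α - 1`, so `K α` dominates both `(1 + q) K` and `K`, uniformly in `q`.
    refine ⟨K * α, by positivity, fun q hq hqα n₀ hn => ?_⟩
    have hm := BaumKatz.measurableSet_maxEvent hmeas α p ε
    have hE : ∫⁻ ω, BaumKatz.overlap (BaumKatz.maxEvent Δ α p ε) n₀ ω ^ (1 + q) ∂P
          ≤ ENNReal.ofReal (K * α) * BaumKatz.zetaFrom (α - 1 - q) n₀ := by
      refine (BaumKatz.lintegral_overlap_rpow_le
        (fun n m hnm => BaumKatz.maxEvent_antitone Δ α p ε hnm) hm hK.le hbound hq hn).trans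
          (mul_le_mul_left (ENNReal.ofReal_le_ofReal ?_) _)
      nlinarith
    refine ⟨BaumKatz.zetaFrom_lt_top (by linarith) n₀, ?_, hE, fun k hk =>
      BaumKatz.measure_le_overlap_le hm hq hE hk⟩
    refine (BaumKatz.tsum_rpow_mul_measure_le hK.le hbound q hn).trans
      (mul_le_mul_left (ENNReal.ofReal_le_ofReal ?_) _)
    nlinarith
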